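/- **Setting.** All logarithms are to base $2$. Let $\mathcal U$ be a finite alphabet of size $\alpha\ge 2$, let $\mathcal X,\mathcal Y,\mathcal Z$ be finite alphabets, and let $k,m$ be positive integers; $\lambda=m/k$ is the bandwidth expansion factor. A stochastic finite-state encoder with $q_e$ states consists of a set $\mathcal S^e$ of $q_e$ states, a fixed initial state $s_0^e$, conditional distributions $P(\tilde x\mid\tilde u,s)$ on $\mathcal X^m$ for $\tilde u\in\mathcal U^k$, $s\in\mathcal S^e$, and a next-state function $h:\mathcal U^k\times\mathcal S^e\to\mathcal S^e$. It reads the source in chunks $\tilde u_0,\tilde u_1,\ldots\in\mathcal U^k$, draws the $i$-th channel input chunk $\tilde X_i$ from $P(\cdot\mid\tilde u_i,s_i^e)$ (independently over $i$), and sets $s_{i+1}^e=h(\tilde u_i,s_i^e)$. The channel inputs pass through a memoryless main channel $Q_M(y\mid x)$ from $\mathcal X$ to $\mathcal Y$, and its outputs pass through a memoryless wiretap channel $Q_W(z\mid y)$ from $\mathcal Y$ to $\mathcal Z$. A deterministic finite-state decoder with $q_d\ge1$ states is given by an output function $f:\mathcal Y^m\times\mathcal S^d\to\mathcal U^k$ and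 a next-state function $g:\mathcal Y^m\times\mathcal S^d\to\mathcal S^d$, with $|\mathcal S^d|=q_d$. The secrecy capacity is $C_s=\max_{P_X}I(X;Y\mid Z)$ under $P_{XYZ}(x,y,z)=P_X(x)Q_M(y\mid x)Q_W(z\mid y)$. *Reliability constraint (level $\epsilon_r$).* For every $u^k\in\mathcal U^k$ and every pair of initial states of the encoder and the decoder, the output $V^k$ of the decoder in response to the first chunk satisfies $\frac1k\sum_{i=1}^k\Pr\{V_i\ne u_i\}\le\epsilon_r$. *Security constraint (level $\epsilon_s$).* For every sufficiently large $n$ divisible by $k$, with $N=n\lambda$, one has $\max_\mu I_\mu(U^n;Z^N)\le n\epsilon_s$, where the maximum is over all distributions $\mu$ of $U^n$, and the encoder starts from $s_0^e$. *LZ complexity.* $\rho_{LZ}(u^n)=\frac{c(u^n)\log c(u^n)}{n}$, where $c(u^n)$ is the number of phrases in the incremental parsing of $u^n$: each new phrase is the shortest string that is not yet a phrase, except that the last phrase may be incomplete. **Theorem 1.** For every $\alpha\ge2$ there is a sequence $\epsilon_n\in[0,1)$, depending only on $\alpha$, with $\epsilon_n\to0$ as $n\to\infty$, such that the following holds. Let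 $0<\epsilon_r\le 1-1/\alpha$ and $\epsilon_s>0$. If, in the above setting, an encoder with $q_e$ states and a decoder with $q_d$ states together satisfy the reliability constraint and the security constraint, then for every $n\ge2$ divisible by $k$ and every $u^n\in\mathcal U^n$, $$\lambda\ \ge\ \frac{\rho_{LZ}(u^n)-\Delta(\epsilon_r)-\epsilon_s-\zeta_n(q_d,k)}{C_s}$$ if $C_s>0$, while the numerator is at most $0$ if $C_s=0$. Here $\Delta(\epsilon_r)=h_2(\epsilon_r)+\epsilon_r\log(\alpha-1)$, $h_2(\epsilon)=-\epsilon\log\epsilon-(1-\epsilon)\log(1-\epsilon)$, and $$\zeta_n(q_d,k)=\min_{\ell\,\mid\, n/k}\left[\frac{\log q_d+1}{k\ell}+\frac{2k\ell(\log\alpha+1)^2}{(1-\epsilon_n)\log n}+\frac{2k\ell\,\alpha^{2k\ell}\log\alpha}{n}\right].$$ -/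

import Mathlib

open scoped BigOperators
open Filter

namespace Wiretap

/-! ### Information measures on finite alphabets (all logarithms are to base 2) -/

section Information

variable {A B C : Type*} [Fintype A] [Fintype B] [Fintype C]

/-- Shannon entropy, in bits, of a probability mass function on a finite set
(with `0 * log 0 = 0`). -/
noncomputable def entropy (p : A → ℝ) : ℝ := ∑ a, -(p a * Real.logb 2 (p a))

/-- Mutual information `I(A;B) = H(A) + H(B) - H(A,B)` under the joint law `p`. -/
noncomputable def mutualInfo (p : A → B → ℝ) : ℝ :=
  entropy (fun a => ∑ b, p a b) + entropy (fun b => ∑ a, p a b)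
    - entropy (fun t : A × B => p t.1 t.2)

/-- Conditional mutual information
`I(A;B|C) = H(A,C) + H(B,C) - H(A,B,C) - H(C)` under the joint law `p`. -/
noncomputable def condMutualInfo (p : A → B → C → ℝ) : ℝ :=
  entropy (fun t : A × C => ∑ b, p t.1 b t.2)
    + entropy (fun t : B × C => ∑ a, p a t.1 t.2)
    - entropy (fun t : A × B × C => p t.1 t.2.1 t.2.2)
    - entropy (fun c => ∑ a, ∑ b, p a b c)

end Information

/-! ### Channels and secrecy capacity -/

/-- Single-letter transition matrix of a discrete memoryless channel. -/
structure DMC (A B : Type*) [Fintype B] where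
  prob : A → B → ℝ
  prob_mem : ∀ a, prob a ∈ stdSimplex ℝ B

/-- Secrecy capacity `max_{P_X} I(X;Y|Z)` of the degraded wiretap channel, where
`P_{XYZ}(x,y,z) = P_X(x) Q_M(y|x) Q_W(z|y)`.  The maximum of a continuous function on the
simplex of input distributions is written as a supremum. -/
noncomputable def secrecyCapacity {X Y Z : Type*} [Fintype X] [Fintype Y] [Fintype Z]
    (QM : DMC X Y) (QW : DMC Y Z) : ℝ :=
  sSup ((fun P : X → ℝ =>
    condMutualInfo (fun x y z => P x * QM.prob x y * QW.prob y z)) '' stdSimplex ℝ X)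

/-! ### Finite-state encoders and decoders -/

/-- A stochastic finite-state encoder: reads chunks in `U^k`, has states in `S`, and emits
random chunks in `X^m`. -/
structure Encoder (U X S : Type*) [Fintype X] (k m : ℕ) where
  /-- `prob u s x` is the conditional probability `P(x | u, s)`. -/
  prob : (Fin k → U) → S → (Fin m → X) → ℝ
  prob_mem : ∀ u s, prob u s ∈ stdSimplex ℝ (Fin m → X)
  /-- next-state function -/
  next : (Fin k → U) → S → S
  /-- the fixed initial state -/
  init : S

/-- A deterministic finite-state decoder: reads chunks in `Y^m`, has states in `S`, and emits
reconstruction chunks in `U^k`. -/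
structure Decoder (U Y S : Type*) (k m : ℕ) where
  /-- output function -/
  out : (Fin m → Y) → S → (Fin k → U)
  /-- next-state function -/
  next : (Fin m → Y) → S → S

section System

variable {U X Y Z Se Sd : Type*} {k m L : ℕ}

/-- The state of the encoder before it reads chunk number `i` (counted from `0`) of the
source string `u` of `L` chunks. -/
def Encoder.state [Fintype X] (E : Encoder U X Se k m) (u : Fin L → Fin k → U) : ℕ → Se
  | 0 => E.init
  | i + 1 => if h : i < L then E.next (u ⟨i, h⟩) (E.state u i) else E.state u i

/-- The conditional law `P(x^N, y^N, z^N | u^n)` of channel inputs, main channel outputs and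
wiretap channel outputs, for `n = k L`, `N = m L`; all strings are written in chunks. -/
noncomputable def systemLaw [Fintype X] [Fintype Y] [Fintype Z]
    (E : Encoder U X Se k m) (QM : DMC X Y) (QW : DMC Y Z)
    (u : Fin L → Fin k → U) (x : Fin L → Fin m → X) (y : Fin L → Fin m → Y)
    (z : Fin L → Fin m → Z) : ℝ :=
  (∏ i, E.prob (u i) (E.state u i) (x i)) * (∏ i, ∏ j, QM.prob (x i j) (y i j))
    * (∏ i, ∏ j, QW.prob (y i j) (z i j))

/-- The conditional law `P(z^N | u^n)` of the wiretap channel outputs. -/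
noncomputable def wiretapLaw [Fintype X] [Fintype Y] [Fintype Z]
    (E : Encoder U X Se k m) (QM : DMC X Y) (QW : DMC Y Z)
    (u : Fin L → Fin k → U) (z : Fin L → Fin m → Z) : ℝ :=
  ∑ x, ∑ y, systemLaw E QM QW u x y z

/-- The bit error probability `(1/k) ∑ᵢ Pr{Vᵢ ≠ uᵢ}` for the source chunk `u` when the encoder
starts from state `se` and the decoder from state `sd`. -/
noncomputable def bitErrorProb [DecidableEq U] [Fintype X] [Fintype Y]
    (E : Encoder U X Se k m) (D : Decoder U Y Sd k m) (QM : DMC X Y)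
    (u : Fin k → U) (se : Se) (sd : Sd) : ℝ :=
  (1 / (k : ℝ)) * ∑ i, ∑ x, ∑ y,
    E.prob u se x * (∏ j, QM.prob (x j) (y j)) * (if D.out y sd i ≠ u i then 1 else 0)

/-- Reliability: the bit error probability is at most `εr` for every source chunk and every
combination of initial states. -/
def Reliable [DecidableEq U] [Fintype X] [Fintype Y]
    (E : Encoder U X Se k m) (D : Decoder U Y Sd k m) (QM : DMC X Y) (εr : ℝ) : Prop :=
  ∀ (u : Fin k → U) (se : Se) (sd : Sd), bitErrorProb E D QM u se sd ≤ εr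

/-- Security: for every sufficiently large number `L` of chunks, i.e. with `n = k L` source
symbols and `N = n (m / k) = m L` channel uses, `I_μ(U^n; Z^N) ≤ n εs` for every
distribution `μ` of the source string `U^n`. -/
def Secure [Fintype U] [Fintype X] [Fintype Y] [Fintype Z]
    (E : Encoder U X Se k m) (QM : DMC X Y) (QW : DMC Y Z) (εs : ℝ) : Prop :=
  ∀ᶠ L : ℕ in atTop, ∀ μ ∈ stdSimplex ℝ (Fin L → Fin k → U),
    mutualInfo (fun (u : Fin L → Fin k → U) (z : Fin L → Fin m → Z) =>
      μ u * wiretapLaw E QM QW u z) ≤ ((k * L : ℕ) : ℝ) * εs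

end System

/-! ### Lempel-Ziv complexity -/

section LZ

variable {U : Type*} [DecidableEq U]

/-- Incremental parsing: `phrases` are the phrases obtained so far, `cur` is the part of the
current phrase already read, and the last argument is the part of the string not yet read.
A phrase ends as soon as it differs from all earlier phrases; a nonempty incomplete last phrase
is kept as a phrase. -/
def lzParseAux (phrases : List (List U)) (cur : List U) : List U → List (List U)
  | [] => if cur = [] then phrases else phrases ++ [cur]
  | a :: rest =>
    if cur ++ [a] ∈ phrases then lzParseAux phrases (cur ++ [a]) rest
    else lzParseAux (phrases ++ [cur ++ [a]]) [] rest

/-- The number `c(u^n)` of phrases in the incremental parsing of `u`. -/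
def lzCount {n : ℕ} (u : Fin n → U) : ℕ := (lzParseAux [] [] (List.ofFn u)).length

/-- The LZ complexity `c(u^n) log c(u^n) / n`. -/
noncomputable def lzComplexity {n : ℕ} (u : Fin n → U) : ℝ :=
  (lzCount u : ℝ) * Real.logb 2 (lzCount u) / n

end LZ

/-! ### The terms of the bound -/

/-- `Δ(ε) = h₂(ε) + ε log (α - 1)`. -/
noncomputable def Delta (α : ℕ) (ε : ℝ) : ℝ :=
  (-(ε * Real.logb 2 ε) - (1 - ε) * Real.logb 2 (1 - ε)) + ε * Real.logb 2 ((α : ℝ) - 1)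

/-- `ζ_n(q_d, k)`, the minimum over the (finitely many) divisors `ℓ` of `n / k`, for a given
value `e` of `ε_n`. -/
noncomputable def zeta (α : ℕ) (e : ℝ) (n qd k : ℕ) : ℝ :=
  sInf ((fun l : ℕ =>
    (Real.logb 2 qd + 1) / ((k : ℝ) * l)
      + 2 * (k : ℝ) * l * (Real.logb 2 α + 1) ^ 2 / ((1 - e) * Real.logb 2 n)
      + 2 * (k : ℝ) * l * (α : ℝ) ^ (2 * k * l) * Real.logb 2 α / n)
    '' ((n / k).divisors : Set ℕ))

end Wiretap

namespace Wiretap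

/-! ### Universal upper bounds on Lempel-Ziv complexity. -/

section LempelZiv

/-! The individual string and the communication system interact only through `log α`.

On the string side, `lzComplexity_le` shows that no string has complexity above `log α + ζ_n`.
Distinct phrases satisfy a Kraft-type inequality, and concavity of the logarithm turns it into a
bound on `c log c`.

On the system side, `logb_card_le` shows `log α ≤ Δ(ε_r) + ε_s + λ C_s`. Feed the system a uniform
source. Security keeps the equivocation `H(U|Z)` within `n ε_s` of `n log α`. Conversely,
`equivocation_le` bounds `H(U|Z)` by the log-loss of any guess of `U` from `Y` plus `C_s` per
channel use; it is one application of Gibbs' inequality to a well-chosen reference measure. Guessing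
through the decoder and a symmetric error model costs at most `Δ(ε_r)` per symbol. Adding the two
inequalities gives the theorem. -/

theorem lzParseAux_spec {U : Type*} [DecidableEq U] (rest : List U) :
    ∀ (phrases : List (List U)) (cur : List U), phrases.Nodup →
      (lzParseAux phrases cur rest).flatten = phrases.flatten ++ cur ++ rest ∧
      ∃ P t : List (List U), lzParseAux phrases cur rest = P ++ t ∧ P.Nodup ∧ t.length ≤ 1 := by
  induction rest with
  | nil =>
    intro phrases cur h
    unfold lzParseAux
    split_ifs with hc
    · exact ⟨by simp [hc], phrases, [], by simp, h, by simp⟩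
    · exact ⟨by simp, phrases, [cur], rfl, h, by simp⟩
  | cons a rest ih =>
    intro phrases cur h
    unfold lzParseAux
    split_ifs with hc
    · obtain ⟨h1, h2⟩ := ih phrases (cur ++ [a]) h
      exact ⟨by simp [h1], h2⟩
    · have hn : (phrases ++ [cur ++ [a]]).Nodup := by
        rw [List.nodup_append]
        refine ⟨h, by simp, ?_⟩
        intro x hx y hy
        simp only [List.mem_singleton] at hy
        rintro rfl
        exact hc (hy ▸ hx)
      obtain ⟨h1, h2⟩ := ih (phrases ++ [cur ++ [a]]) [] hn
      exact ⟨by simp [h1], h2⟩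

/-- Supplies the count per length that makes the words of length `j` contribute at most `θ ^ j` in
the Kraft-type sum. -/
theorem card_filter_length_le {U : Type*} [Fintype U] (W : Finset (List U)) (j : ℕ) :
    (W.filter (fun w => w.length = j)).card ≤ Fintype.card U ^ j := by
  classical
  rw [← card_vector (α := U) j, ← Finset.card_univ]
  have : W.filter (fun w => w.length = j) ⊆
      (Finset.univ : Finset (List.Vector U j)).image fun v => v.toList := by
    intro w hw
    simp only [Finset.mem_filter] at hw
    exact Finset.mem_image.2 ⟨(⟨w, hw.2⟩ : List.Vector U j), Finset.mem_univ _, rfl⟩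
  exact (Finset.card_le_card this).trans Finset.card_image_le

/-- A Kraft-type inequality for arbitrary finite sets of words. -/
theorem sum_pow_length_le {U : Type*} [Fintype U] [Nonempty U] (W : Finset (List U)) {θ : ℝ}
    (h0 : 0 ≤ θ) (h1 : θ < 1) :
    ∑ w ∈ W, (θ / Fintype.card U) ^ w.length ≤ (1 - θ)⁻¹ := by
  classical
  have hα : (0 : ℝ) < Fintype.card U := by exact_mod_cast Fintype.card_pos
  rw [← Finset.sum_fiberwise_of_maps_to (g := List.length) (t := W.image List.length)
    (fun w hw => Finset.mem_image_of_mem _ hw)]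
  rw [← tsum_geometric_of_lt_one h0 h1]
  refine le_trans (Finset.sum_le_sum fun j _ => ?_)
    ((summable_geometric_of_lt_one h0 h1).sum_le_tsum (W.image List.length)
      (fun i _ => pow_nonneg h0 i))
  have : ∑ w ∈ W with w.length = j, (θ / Fintype.card U) ^ w.length
      = (W.filter (fun w => w.length = j)).card * (θ / Fintype.card U) ^ j := by
    rw [← nsmul_eq_mul]
    exact Finset.sum_eq_card_nsmul fun w hw => by rw [(Finset.mem_filter.1 hw).2]
  rw [this]
  have hc : ((W.filter (fun w => w.length = j)).card : ℝ) ≤ (Fintype.card U : ℝ) ^ j := by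
    exact_mod_cast card_filter_length_le W j
  calc _ ≤ (Fintype.card U : ℝ) ^ j * (θ / Fintype.card U) ^ j := by gcongr
    _ = θ ^ j := by rw [← mul_pow, mul_div_cancel₀ _ hα.ne']

/-- Jensen's inequality for the logarithm, proved with the tangent line at `S / c`, where `c` is the
number of terms. -/
theorem list_sum_log_le (xs : List ℝ) (hx : ∀ x ∈ xs, 0 < x) {S : ℝ} (hS : xs.sum ≤ S) :
    xs.length * Real.logb 2 xs.length + (xs.map (Real.logb 2)).sum
      ≤ xs.length * Real.logb 2 S := by
  rcases Nat.eq_zero_or_pos xs.length with h | h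
  · have := List.length_eq_zero_iff.1 h
    subst this; simp
  have hne : xs ≠ [] := by rintro rfl; simp at h
  have hsum : 0 < xs.sum := List.sum_pos xs hx hne
  have hSp : 0 < S := hsum.trans_le hS
  set c : ℝ := (xs.length : ℝ) with hc
  have hcp : 0 < c := by rw [hc]; exact_mod_cast h
  have hl2 : 0 < Real.log 2 := Real.log_pos (by norm_num)
  have key : ∀ x ∈ xs, Real.logb 2 x ≤
      (c / S / Real.log 2) * x + (Real.logb 2 S - Real.logb 2 c - 1 / Real.log 2) := by
    intro x hxm
    have hxp := hx x hxm
    have h1 := Real.log_le_sub_one_of_pos (show 0 < x * (c / S) by positivity)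
    rw [Real.log_mul hxp.ne' (by positivity), Real.log_div hcp.ne' hSp.ne'] at h1
    simp only [Real.logb]
    have : Real.log x / Real.log 2 ≤
      (x * (c / S) - 1 + Real.log S - Real.log c) / Real.log 2 := by
      gcongr; linarith
    refine this.trans (le_of_eq ?_)
    field_simp
    ring
  have h2 : (xs.map (Real.logb 2)).sum ≤ (xs.map fun x => (c / S / Real.log 2) * x +
      (Real.logb 2 S - Real.logb 2 c - 1 / Real.log 2)).sum := List.sum_le_sum key
  rw [List.sum_map_add, List.sum_map_mul_left, List.map_id', List.map_const', List.sum_replicate,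
    nsmul_eq_mul, ← hc] at h2
  have h3 : c / S / Real.log 2 * xs.sum ≤ c / S / Real.log 2 * S := by gcongr
  have h4 : c / S / Real.log 2 * S = c / Real.log 2 := by field_simp
  have h5 : c * (Real.logb 2 S - Real.logb 2 c - 1 / Real.log 2)
    = c * Real.logb 2 S - c * Real.logb 2 c - c / Real.log 2 := by ring
  linarith

/-- Jensen is applied to the weights `(θ/α)^|w|` of the phrases. Phrase lengths add up to `n`, so
the logarithms sum to `n log (θ/α)`. The complete phrases are distinct and have total weight at most
`(1-θ)⁻¹`; the `+ 1` pays for a possibly repeated last phrase. -/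
theorem lzCount_mul_logb_le {U : Type*} [Fintype U] [Nonempty U] [DecidableEq U] {n : ℕ}
    (u : Fin n → U) {θ : ℝ} (h0 : 0 < θ) (h1 : θ < 1) :
    (lzCount u : ℝ) * Real.logb 2 (lzCount u) ≤
      n * (Real.logb 2 (Fintype.card U) - Real.logb 2 θ)
        + lzCount u * Real.logb 2 ((1 - θ)⁻¹ + 1) := by
  obtain ⟨hfl, P, t, hPt, hP, ht⟩ := lzParseAux_spec (List.ofFn u) [] [] List.nodup_nil
  have hα : (1 : ℝ) ≤ Fintype.card U := by exact_mod_cast Fintype.card_pos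
  have hβ : 0 < θ / Fintype.card U := by positivity
  have hβ1 : θ / Fintype.card U ≤ 1 := by
    rw [div_le_one (by linarith)]; linarith
  unfold lzCount
  set ps := lzParseAux [] [] (List.ofFn u) with hps
  have hlen : (ps.map List.length).sum = n := by
    rw [← List.length_flatten, hfl]; simp
  set f : List U → ℝ := fun w => (θ / Fintype.card U) ^ w.length with hf
  have hsum : (ps.map f).sum ≤ (1 - θ)⁻¹ + 1 := by
    rw [hPt, List.map_append, List.sum_append]
    refine add_le_add ?_ ?_
    · rw [← List.sum_toFinset f hP]
      exact sum_pow_length_le P.toFinset h0.le h1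
    · match t, ht with
      | [], _ => simp
      | [w], _ => simpa [hf] using pow_le_one₀ hβ.le hβ1
  have h2 := list_sum_log_le (ps.map f) (by
    intro x hx
    obtain ⟨w, _, rfl⟩ := List.mem_map.1 hx
    exact pow_pos hβ _) hsum
  rw [List.length_map, List.map_map] at h2
  have h3 : (ps.map (Real.logb 2 ∘ f)).sum = n * Real.logb 2 (θ / Fintype.card U) := by
    have : (Real.logb 2 ∘ f) =
        fun w => (fun j : ℕ => (j : ℝ)) w.length * Real.logb 2 (θ / Fintype.card U) := by
      funext w
      simp [hf, Real.logb_pow]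
    rw [this, List.sum_map_mul_right]
    congr 1
    rw [← hlen]
    simp [Function.comp_def]
  rw [h3, Real.logb_div h0.ne' (by linarith)] at h2
  linarith

theorem lzCount_mul_logb_le_of_pos {U : Type*} [Fintype U] [Nonempty U] [DecidableEq U] {n : ℕ}
    (u : Fin n → U) {b : ℕ} (hb : 0 < b) :
    (lzCount u : ℝ) * Real.logb 2 (lzCount u) ≤
      n * Real.logb 2 (Fintype.card U) + n / b + lzCount u * Real.logb 2 (2 * b + 1) := by
  have hb1 : (1 : ℝ) ≤ b := by exact_mod_cast hb
  -- This choice makes `(1-θ)⁻¹ = 2b`, while Bernoulli gives `θ^b ≥ 1/2`, hence `-log θ ≤ 1/b`.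
  -- Later `b = kℓ`, to match the `1/(kℓ)` in `zeta`.
  set θ : ℝ := 1 - 1 / (2 * b) with hθ
  have hx : 1 / (2 * (b : ℝ)) ≤ 1 / 2 := by
    apply one_div_le_one_div_of_le <;> linarith
  have hx0 : 0 < 1 / (2 * (b : ℝ)) := by positivity
  have h0 : 0 < θ := by linarith
  have h1 : θ < 1 := by linarith
  have h2 := lzCount_mul_logb_le u h0 h1
  have h3 : (1 - θ)⁻¹ = 2 * b := by rw [hθ]; simp
  rw [h3] at h2
  have h4 : (1 / 2 : ℝ) ≤ θ ^ b := by
    have := one_add_mul_le_pow (show (-2 : ℝ) ≤ -(1 / (2 * b)) by linarith) b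
    have e : 1 + (b : ℝ) * -(1 / (2 * b)) = 1 / 2 := by field_simp; norm_num
    rw [e] at this
    rwa [hθ, sub_eq_add_neg]
  have h5 : -1 ≤ b * Real.logb 2 θ := by
    rw [← Real.logb_pow]
    have : Real.logb 2 (1 / 2) ≤ Real.logb 2 (θ ^ b) :=
      Real.logb_le_logb_of_le (by norm_num) (by norm_num) h4
    rwa [one_div, Real.logb_inv, Real.logb_self_eq_one (by norm_num)] at this
  have h6 : -Real.logb 2 θ ≤ 1 / b := by
    rw [le_div_iff₀ (by linarith)]; linarith
  have h7 : (n : ℝ) * (-Real.logb 2 θ) ≤ n * (1 / b) := by gcongr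
  rw [mul_one_div] at h7
  linarith

theorem logb_two_three_le : Real.logb 2 3 ≤ 8 / 5 := by
  rw [Real.logb_le_iff_le_rpow (by norm_num) (by norm_num)]
  -- 243 ≤ 256.
  have h : ((3 : ℝ) ^ 5) ^ (1 / 5 : ℝ) ≤ ((2 : ℝ) ^ 8) ^ (1 / 5 : ℝ) :=
    Real.rpow_le_rpow (by norm_num) (by norm_num) (by norm_num)
  rw [← Real.rpow_natCast, ← Real.rpow_natCast, ← Real.rpow_mul (by norm_num),
    ← Real.rpow_mul (by norm_num)] at h
  norm_num at h ⊢
  exact h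

theorem logb_two_le_sqrt {x : ℝ} (hx : 0 < x) : Real.logb 2 x ≤ 5 / 3 * √x := by
  have hl2 := Real.log_two_gt_d9
  -- With `y = x^(1/4)`, `ln x = 4 ln y ≤ 4(y-1) ≤ y²`; then `1 / ln 2 ≤ 5/3`.
  set y := √(√x) with hy
  have hyp : 0 < y := by positivity
  have h1 : y ^ 2 = √x := Real.sq_sqrt (by positivity)
  have h2 : x = y ^ 4 := by
    rw [show y ^ 4 = (y ^ 2) ^ 2 by ring, h1, Real.sq_sqrt hx.le]
  have h3 := Real.log_le_sub_one_of_pos hyp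
  have h4 : Real.log x ≤ y ^ 2 := by
    rw [h2, Real.log_pow]
    push_cast
    nlinarith [sq_nonneg (y - 2)]
  rw [← h1, Real.logb, div_le_iff₀ (by linarith)]
  nlinarith [sq_nonneg y]

/-- The number of phrases is `O(n / log n)`. -/
theorem lzCount_mul_logb_length_le {U : Type*} [Fintype U] [DecidableEq U]
    (hU : 2 ≤ Fintype.card U) {n : ℕ} (hn : 2 ≤ n) (u : Fin n → U) :
    (lzCount u : ℝ) * Real.logb 2 n ≤
      5 / 2 * n * (Real.logb 2 (Fintype.card U) + 1) := by
  have : Nonempty U := Fintype.card_pos_iff.1 (by omega)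
  have hα : 1 ≤ Real.logb 2 (Fintype.card U) := by
    rw [Real.le_logb_iff_rpow_le (by norm_num) (by exact_mod_cast (by omega : 0 < Fintype.card U))]
    simpa using (by exact_mod_cast hU : (2 : ℝ) ≤ Fintype.card U)
  have hnp : (0 : ℝ) < n := by exact_mod_cast (by omega : 0 < n)
  have hmain := lzCount_mul_logb_le_of_pos u one_pos
  norm_num at hmain
  set c : ℝ := (lzCount u : ℝ)
  set a := Real.logb 2 (Fintype.card U)
  have hs : 0 < √(n : ℝ) := by positivity
  have hss : √(n : ℝ) * √(n : ℝ) = n := Real.mul_self_sqrt hnp.le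
  -- Few phrases: the crude bound on `log n` suffices. Many phrases: `log c ≥ log 3 + (log n)/2`,
  -- and the threshold factor 3 cancels the term `c log 3` that `hmain` has for `b = 1`.
  rcases le_or_gt c (3 * √(n : ℝ)) with h | h
  · have h1 := logb_two_le_sqrt hnp
    have h2 : 0 ≤ Real.logb 2 (n : ℝ) :=
      Real.logb_nonneg (by norm_num) (by exact_mod_cast (by omega : 1 ≤ n))
    calc c * Real.logb 2 n ≤ (3 * √(n : ℝ)) * (5 / 3 * √(n : ℝ)) := by gcongr
      _ = 5 * n := by linear_combination 5 * hss
      _ ≤ _ := by nlinarith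
  · have hc : 0 < c := by linarith [hs]
    have h1 : Real.logb 2 (3 * √(n : ℝ)) ≤ Real.logb 2 c :=
      Real.logb_le_logb_of_le (by norm_num) (by positivity) h.le
    rw [Real.logb_mul (by norm_num) hs.ne'] at h1
    have h2 : Real.logb 2 (√(n : ℝ)) = Real.logb 2 n / 2 := by
      simp only [Real.logb]
      rw [Real.log_sqrt hnp.le]; ring
    rw [h2] at h1
    have h3 : c * (Real.logb 2 3 + Real.logb 2 n / 2) ≤ c * Real.logb 2 c := by gcongr
    nlinarith

/-- The LZ complexity exceeds the logarithm of the alphabet size by at most `ζ_n`, already for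
`ε_n = 0`. -/
theorem lzComplexity_le {U : Type*} [Fintype U] [DecidableEq U]
    (hU : 2 ≤ Fintype.card U) {n k qd : ℕ} (hn : 2 ≤ n) (hk : 0 < k) (hkn : k ∣ n) (hq : 0 < qd)
    (u : Fin n → U) :
    lzComplexity u ≤ Real.logb 2 (Fintype.card U) + zeta (Fintype.card U) 0 n qd k := by
  have : Nonempty U := Fintype.card_pos_iff.1 (by omega)
  have hα : 1 ≤ Real.logb 2 (Fintype.card U) := by
    rw [Real.le_logb_iff_rpow_le (by norm_num) (by exact_mod_cast (by omega : 0 < Fintype.card U))]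
    simpa using (by exact_mod_cast hU : (2 : ℝ) ≤ Fintype.card U)
  have hnp : (0 : ℝ) < n := by exact_mod_cast (by omega : 0 < n)
  have hlogn : 0 < Real.logb 2 (n : ℝ) :=
    Real.logb_pos (by norm_num) (by exact_mod_cast (by omega : 1 < n))
  have hdiv : n / k ≠ 0 := (Nat.div_pos (Nat.le_of_dvd (by omega) hkn) hk).ne'
  rw [← sub_le_iff_le_add']
  -- The bound is proved for every divisor `ℓ`; the divisor 1 only shows that the infimum is over a
  -- nonempty set.
  refine le_csInf ⟨_, Set.mem_image_of_mem _
    (Finset.mem_coe.2 (Nat.one_mem_divisors.2 hdiv))⟩ ?_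
  rintro _ ⟨l, hl, rfl⟩
  have hl0 : 0 < l := Nat.pos_of_mem_divisors (Finset.mem_coe.1 hl)
  have hb : 0 < k * l := Nat.mul_pos hk hl0
  have hmain := lzCount_mul_logb_le_of_pos u hb
  have hcount := lzCount_mul_logb_length_le hU hn u
  have hb1 : (1 : ℝ) ≤ (k * l : ℕ) := by exact_mod_cast hb
  have hlog3 : Real.logb 2 (2 * (k * l : ℕ) + 1) ≤ (k * l : ℕ) * (8 / 5) := by
    refine le_trans ?_ (mul_le_mul_of_nonneg_left logb_two_three_le (by positivity))
    rw [← Real.logb_pow]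
    refine Real.logb_le_logb_of_le (by norm_num) (by positivity) ?_
    have := one_add_mul_le_pow (show (-2 : ℝ) ≤ 2 by norm_num) (k * l)
    norm_num at this ⊢
    linarith
  unfold lzComplexity
  set c : ℝ := (lzCount u : ℝ)
  have hc0 : 0 ≤ c := Nat.cast_nonneg _
  set a := Real.logb 2 (Fintype.card U)
  push_cast at hmain hlog3 hb1
  have hkl : 0 < (k : ℝ) * l := by linarith
  have hqd : 0 ≤ Real.logb 2 (qd : ℝ) :=
    Real.logb_nonneg (by norm_num) (by exact_mod_cast hq)
  have t1 : 1 / ((k : ℝ) * l) ≤ (Real.logb 2 qd + 1) / ((k : ℝ) * l) := by gcongr; linarith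
  have t3 : 0 ≤ 2 * (k : ℝ) * l * (Fintype.card U : ℝ) ^ (2 * k * l) * a / n := by positivity
  have hc : c ≤ 5 / 2 * n * (a + 1) / Real.logb 2 n := by rwa [le_div_iff₀ hlogn]
  -- The constants meet exactly: `5/2 · 8/5 = 2 · 2`, and `2 ≤ log α + 1`.
  have t2 : c * Real.logb 2 (2 * (k * l) + 1) / n ≤
      2 * (k : ℝ) * l * (a + 1) ^ 2 / ((1 - 0) * Real.logb 2 n) := by
    calc c * Real.logb 2 (2 * (k * l) + 1) / n
        ≤ (5 / 2 * n * (a + 1) / Real.logb 2 n) * (k * l * (8 / 5)) / n := by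
          gcongr
          exact Real.logb_nonneg (by norm_num) (by linarith)
      _ = 2 * (k : ℝ) * l * (a + 1) * 2 / Real.logb 2 n := by field_simp; norm_num
      _ ≤ 2 * (k : ℝ) * l * (a + 1) * (a + 1) / Real.logb 2 n := by gcongr; linarith
      _ = _ := by rw [sub_zero, one_mul]; ring
  have t0 : c * Real.logb 2 c / n ≤ a + 1 / (k * l) + c * Real.logb 2 (2 * (k * l) + 1) / n := by
    rw [div_le_iff₀ hnp]
    refine hmain.trans (le_of_eq ?_)
    field_simp
  linarith

end LempelZiv

end Wiretap

namespace Wiretap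

/-! ### Gibbs' inequality and identities for finite laws. -/

section Gibbs

/-- Gibbs' inequality from `ln t ≤ t - 1`. The reference `r` may have less mass than `p`, which is
what the equivocation bound needs. -/
theorem sum_mul_logb_sub_le {Ω : Type*} [Fintype Ω] (p r : Ω → ℝ) (hp : ∀ ω, 0 ≤ p ω)
    (hr : ∀ ω, 0 ≤ r ω) (hpos : ∀ ω, 0 < p ω → 0 < r ω) (hsum : ∑ ω, r ω ≤ ∑ ω, p ω) :
    ∑ ω, p ω * (Real.logb 2 (r ω) - Real.logb 2 (p ω)) ≤ 0 := by
  have hl2 : 0 < Real.log 2 := Real.log_pos (by norm_num)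
  have key : ∀ ω, p ω * (Real.logb 2 (r ω) - Real.logb 2 (p ω)) ≤ (r ω - p ω) / Real.log 2 := by
    intro ω
    rcases (hp ω).eq_or_lt with h | h
    · rw [← h, zero_mul]
      exact div_nonneg (by simpa using hr ω) hl2.le
    · have hrp := hpos ω h
      have h1 := Real.log_le_sub_one_of_pos (div_pos hrp h)
      rw [Real.log_div hrp.ne' h.ne'] at h1
      have h2 := mul_le_mul_of_nonneg_left h1 h.le
      rw [mul_sub, mul_sub, mul_div_cancel₀ _ h.ne', mul_one] at h2
      simp only [Real.logb]
      rw [← sub_div, ← mul_div_assoc]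
      gcongr
      linarith
  refine (Finset.sum_le_sum fun ω _ => key ω).trans ?_
  rw [← Finset.sum_div, Finset.sum_sub_distrib]
  exact div_nonpos_of_nonpos_of_nonneg (by linarith) hl2.le

theorem sum_prod_eq_one {ι A : Type*} [Fintype ι] [DecidableEq ι] [Fintype A] (p : ι → A → ℝ)
    (hp : ∀ i, ∑ a, p i a = 1) : ∑ x : ι → A, ∏ i, p i (x i) = 1 := by
  rw [← Fintype.prod_sum]
  simp [hp]

/-- Marginalization of a product law: absorbing `g` into the `j`-th factor keeps the product form,
and the other factors sum to 1. -/
theorem sum_prod_mul_eval {ι A : Type*} [Fintype ι] [DecidableEq ι] [Fintype A] (p : ι → A → ℝ)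
    (hp : ∀ i, ∑ a, p i a = 1) (j : ι) (g : A → ℝ) :
    ∑ x : ι → A, (∏ i, p i (x i)) * g (x j) = ∑ a, p j a * g a := by
  have h : ∀ x : ι → A, (∏ i, p i (x i)) * g (x j)
      = ∏ i, (p i (x i) * if i = j then g (x i) else 1) := by
    intro x
    rw [Finset.prod_mul_distrib, Finset.prod_ite_eq' Finset.univ j (fun i => g (x i))]
    simp
  simp only [h]
  rw [← Fintype.prod_sum (fun i a => p i a * if i = j then g a else 1),
    Finset.prod_eq_single j]
  · simp
  · intro i _ hij
    simp [hij, hp]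
  · simp

theorem entropy_comp_equiv {A B : Type*} [Fintype A] [Fintype B] (e : A ≃ B) (p : B → ℝ) :
    entropy (fun a => p (e a)) = entropy p :=
  e.sum_comp (fun b => -(p b * Real.logb 2 (p b)))

theorem entropy_const {A : Type*} [Fintype A] [Nonempty A] :
    entropy (fun _ : A => (Fintype.card A : ℝ)⁻¹) = Real.logb 2 (Fintype.card A) := by
  have : (Fintype.card A : ℝ) ≠ 0 := by exact_mod_cast Fintype.card_ne_zero
  simp [entropy, Real.logb_inv, this]

theorem condMutualInfo_eq_sum {A B C : Type*} [Fintype A] [Fintype B] [Fintype C]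
    (p : A → B → C → ℝ) :
    condMutualInfo p = ∑ a, ∑ b, ∑ c, p a b c *
      (Real.logb 2 (p a b c) + Real.logb 2 (∑ a', ∑ b', p a' b' c)
        - Real.logb 2 (∑ b', p a b' c) - Real.logb 2 (∑ a', p a' b c)) := by
  unfold condMutualInfo entropy
  have h1 : ∑ t : A × C, -((∑ b, p t.1 b t.2) * Real.logb 2 (∑ b, p t.1 b t.2))
      = ∑ a, ∑ b, ∑ c, -(p a b c * Real.logb 2 (∑ b', p a b' c)) := by
    rw [Fintype.sum_prod_type]
    refine Finset.sum_congr rfl fun a _ => ?_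
    rw [Finset.sum_comm]
    refine Finset.sum_congr rfl fun c _ => ?_
    rw [Finset.sum_mul, Finset.sum_neg_distrib]
  have h2 : ∑ t : B × C, -((∑ a, p a t.1 t.2) * Real.logb 2 (∑ a, p a t.1 t.2))
      = ∑ a, ∑ b, ∑ c, -(p a b c * Real.logb 2 (∑ a', p a' b c)) := by
    rw [Fintype.sum_prod_type]
    symm
    rw [Finset.sum_comm]
    refine Finset.sum_congr rfl fun b _ => ?_
    rw [Finset.sum_comm]
    refine Finset.sum_congr rfl fun c _ => ?_
    rw [Finset.sum_mul, Finset.sum_neg_distrib]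
  have h3 : ∑ t : A × B × C, -(p t.1 t.2.1 t.2.2 * Real.logb 2 (p t.1 t.2.1 t.2.2))
      = ∑ a, ∑ b, ∑ c, -(p a b c * Real.logb 2 (p a b c)) := by
    rw [Fintype.sum_prod_type]
    exact Finset.sum_congr rfl fun a _ => Fintype.sum_prod_type _
  have h4 : ∑ c, -((∑ a, ∑ b, p a b c) * Real.logb 2 (∑ a, ∑ b, p a b c))
      = ∑ a, ∑ b, ∑ c, -(p a b c * Real.logb 2 (∑ a', ∑ b', p a' b' c)) := by
    symm
    refine (Finset.sum_congr rfl fun a _ => Finset.sum_comm).trans ?_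
    rw [Finset.sum_comm]
    refine Finset.sum_congr rfl fun c _ => ?_
    rw [Finset.sum_mul, ← Finset.sum_neg_distrib]
    refine Finset.sum_congr rfl fun a _ => ?_
    rw [Finset.sum_mul, ← Finset.sum_neg_distrib]
  rw [h1, h2, h3, h4]
  simp only [← Finset.sum_add_distrib, ← Finset.sum_sub_distrib]
  refine Finset.sum_congr rfl fun a _ => Finset.sum_congr rfl fun b _ =>
    Finset.sum_congr rfl fun c _ => ?_
  ring

end Gibbs

/-! ### Single-letter secrecy capacity. -/

section Capacity

variable {X Y Z : Type*} [Fintype Y] [Fintype Z]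

theorem DMC.prob_nonneg {A B : Type*} [Fintype B] (Q : DMC A B) (a : A) (b : B) :
    0 ≤ Q.prob a b := (Q.prob_mem a).1 b

theorem DMC.sum_prob {A B : Type*} [Fintype B] (Q : DMC A B) (a : A) :
    ∑ b, Q.prob a b = 1 := (Q.prob_mem a).2

theorem continuous_entropy {A T : Type*} [Fintype A] [TopologicalSpace T] (p : T → A → ℝ)
    (hp : ∀ a, Continuous fun t => p t a) : Continuous fun t => entropy (p t) := by
  unfold entropy
  refine continuous_finsetSum _ fun a _ => ?_
  have : (fun t => -(p t a * Real.logb 2 (p t a)))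
      = fun t => -((p t a * Real.log (p t a)) / Real.log 2) := by
    funext t; simp only [Real.logb]; ring
  rw [this]
  exact ((Real.continuous_mul_log.comp (hp a)).div_const _).neg

/-- Continuity on the compact simplex makes the set bounded above; otherwise the real `sSup` would
be the default 0. -/
theorem condMutualInfo_le_secrecyCapacity [Fintype X] (QM : DMC X Y) (QW : DMC Y Z) {P : X → ℝ}
    (hP : P ∈ stdSimplex ℝ X) :
    condMutualInfo (fun x y z => P x * QM.prob x y * QW.prob y z) ≤ secrecyCapacity QM QW := by
  refine le_csSup ?_ (Set.mem_image_of_mem _ hP)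
  refine (isCompact_stdSimplex ℝ X).bddAbove_image (Continuous.continuousOn ?_)
  unfold condMutualInfo
  refine ((Continuous.add ?_ ?_).sub ?_).sub ?_ <;>
  · refine continuous_entropy _ fun a => ?_
    fun_prop

/-- Transition probabilities of the cascade of two channels. -/
noncomputable def cascade (QM : DMC X Y) (QW : DMC Y Z) (x : X) (z : Z) : ℝ :=
  ∑ y, QM.prob x y * QW.prob y z

theorem cascade_nonneg (QM : DMC X Y) (QW : DMC Y Z) (x : X) (z : Z) : 0 ≤ cascade QM QW x z :=
  Finset.sum_nonneg fun y _ => mul_nonneg (QM.prob_nonneg x y) (QW.prob_nonneg y z)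

/-- `log P x` cancels between the laws of `(x,y,z)` and `(x,z)`. The result is an average over `x`
alone of channel expectations, the form that single-letterization produces. -/
theorem condMutualInfo_channel [Fintype X] (QM : DMC X Y) (QW : DMC Y Z) {P : X → ℝ}
    (hP : ∀ x, 0 ≤ P x) :
    condMutualInfo (fun x y z => P x * QM.prob x y * QW.prob y z)
      = ∑ x, P x * ∑ y, QM.prob x y * ∑ z, QW.prob y z *
        (Real.logb 2 (QM.prob x y) + Real.logb 2 (QW.prob y z)
          + Real.logb 2 (∑ x', ∑ y', P x' * QM.prob x' y' * QW.prob y' z)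
          - Real.logb 2 (cascade QM QW x z)
          - Real.logb 2 (∑ x', P x' * QM.prob x' y * QW.prob y z)) := by
  rw [condMutualInfo_eq_sum]
  refine Finset.sum_congr rfl fun x _ => ?_
  rw [Finset.mul_sum]
  refine Finset.sum_congr rfl fun y _ => ?_
  rw [← mul_assoc, Finset.mul_sum]
  refine Finset.sum_congr rfl fun z _ => ?_
  rw [← mul_assoc]
  rcases (hP x).eq_or_lt with h1 | h1
  · simp [← h1]
  rcases (QM.prob_nonneg x y).eq_or_lt with h2 | h2
  · simp [← h2]
  rcases (QW.prob_nonneg y z).eq_or_lt with h3 | h3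
  · simp [← h3]
  have hK : 0 < cascade QM QW x z :=
    (mul_pos h2 h3).trans_le (Finset.single_le_sum
      (f := fun y => QM.prob x y * QW.prob y z)
      (fun y _ => mul_nonneg (QM.prob_nonneg x y) (QW.prob_nonneg y z)) (Finset.mem_univ y))
  have h4 : ∑ b', P x * QM.prob x b' * QW.prob b' z = P x * cascade QM QW x z := by
    simp only [cascade, Finset.mul_sum, mul_assoc]
  rw [h4, Real.logb_mul (mul_pos h1 h2).ne' h3.ne', Real.logb_mul h1.ne' h2.ne',
    Real.logb_mul h1.ne' hK.ne']
  ring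

end Capacity

/-! ### Equivocation bound for the degraded wiretap channel. -/

section Converse

variable {V ι X Y Z : Type*} [Fintype V] [Fintype ι] [DecidableEq ι] [Fintype X] [Fintype Y]
  [Fintype Z]

/-- Law of the outputs of the memoryless cascade when the inputs have law `F`. -/
noncomputable def outputLaw (F : (ι → X) → ℝ) (QM : DMC X Y) (QW : DMC Y Z) (z : ι → Z) : ℝ :=
  ∑ x, F x * ∏ t, cascade QM QW (x t) (z t)

theorem outputLaw_eq_sum (F : (ι → X) → ℝ) (QM : DMC X Y) (QW : DMC Y Z) (z : ι → Z) :
    outputLaw F QM QW z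
      = ∑ x, F x * ∑ y : ι → Y, (∏ t, QM.prob (x t) (y t)) * ∏ t, QW.prob (y t) (z t) := by
  unfold outputLaw cascade
  refine Finset.sum_congr rfl fun x _ => ?_
  rw [Fintype.prod_sum]
  simp only [Finset.prod_mul_distrib]

theorem sum_mul_outputLaw (F : (ι → X) → ℝ) (QM : DMC X Y) (QW : DMC Y Z) (g : (ι → Z) → ℝ) :
    ∑ z, outputLaw F QM QW z * g z
      = ∑ x, F x * ∑ y : ι → Y, (∏ t, QM.prob (x t) (y t)) *
        ∑ z, (∏ t, QW.prob (y t) (z t)) * g z := by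
  simp only [outputLaw_eq_sum, Finset.sum_mul, Finset.mul_sum]
  rw [Finset.sum_comm]
  refine Finset.sum_congr rfl fun x _ => ?_
  rw [Finset.sum_comm]
  refine Finset.sum_congr rfl fun y _ => Finset.sum_congr rfl fun z _ => ?_
  ring

theorem sum_outputLaw {F : (ι → X) → ℝ} (hF : ∑ x, F x = 1) (QM : DMC X Y) (QW : DMC Y Z) :
    ∑ z, outputLaw F QM QW z = 1 := by
  have h := sum_mul_outputLaw F QM QW (fun _ => 1)
  simp only [mul_one] at h
  rw [h]
  simp only [sum_prod_eq_one _ (fun t => QW.sum_prob _), mul_one,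
    sum_prod_eq_one _ (fun t => QM.sum_prob _), hF]

theorem outputLaw_nonneg {F : (ι → X) → ℝ} (hF : ∀ x, 0 ≤ F x) (QM : DMC X Y) (QW : DMC Y Z)
    (z : ι → Z) : 0 ≤ outputLaw F QM QW z :=
  Finset.sum_nonneg fun x _ => mul_nonneg (hF x)
    (Finset.prod_nonneg fun _ _ => cascade_nonneg QM QW _ _)

/-- Equivocation bound: for every conditional law `q` of the message given the main channel
output, `H(U|Z) ≤ E[-log q(U|Y)] + ∑ₜ I(Xₜ;Yₜ|Zₜ)`, and each summand is at most the secrecy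
capacity. -/
theorem equivocation_le (μ : V → ℝ) (hμ : μ ∈ stdSimplex ℝ V) (F : V → (ι → X) → ℝ)
    (hF : ∀ u, F u ∈ stdSimplex ℝ (ι → X)) (QM : DMC X Y) (QW : DMC Y Z)
    (q : V → (ι → Y) → ℝ) (hq : ∀ u y, 0 < q u y) (hq1 : ∀ y, ∑ u, q u y ≤ 1) :
    entropy (fun t : V × (ι → Z) => μ t.1 * outputLaw (F t.1) QM QW t.2)
      - entropy (fun z : ι → Z => ∑ u, μ u * outputLaw (F u) QM QW z)
      ≤ (∑ u, μ u * ∑ x, F u x * ∑ y : ι → Y, (∏ t, QM.prob (x t) (y t)) *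
          -Real.logb 2 (q u y))
        + Fintype.card ι * secrecyCapacity QM QW := by
  classical
  -- The law of the single input `X_t`, a competitor in the definition of `secrecyCapacity`.
  set P : ι → X → ℝ := fun t a => ∑ u, μ u * ∑ x, F u x * if x t = a then 1 else 0 with hPdef
  have hPmarg : ∀ t (g : X → ℝ), ∑ a, P t a * g a = ∑ u, μ u * ∑ x, F u x * g (x t) := by
    intro t g
    simp only [hPdef, Finset.sum_mul, Finset.mul_sum]
    rw [Finset.sum_comm]
    refine Finset.sum_congr rfl fun u _ => ?_
    rw [Finset.sum_comm]
    refine Finset.sum_congr rfl fun x _ => ?_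
    simp [mul_assoc]
  have hPpos : ∀ t a, 0 ≤ P t a := fun t a => Finset.sum_nonneg fun u _ =>
    mul_nonneg (hμ.1 u) (Finset.sum_nonneg fun x _ => mul_nonneg ((hF u).1 x)
      (by split_ifs <;> norm_num))
  have hPsimplex : ∀ t, P t ∈ stdSimplex ℝ X := by
    refine fun t => ⟨hPpos t, ?_⟩
    have h := hPmarg t (fun _ => 1)
    simp only [mul_one, (hF _).2, hμ.2] at h
    exact h
  set YZ : ι → Y → Z → ℝ := fun t b c => ∑ a, P t a * QM.prob a b * QW.prob b c with hYZ
  set Zt : ι → Z → ℝ := fun t c => ∑ a, ∑ b, P t a * QM.prob a b * QW.prob b c with hZt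
  have hYZ0 : ∀ t b c, 0 ≤ YZ t b c := fun t b c => Finset.sum_nonneg fun a _ =>
    mul_nonneg (mul_nonneg (hPpos t a) (QM.prob_nonneg a b)) (QW.prob_nonneg b c)
  have hZtsum : ∀ t c, Zt t c = ∑ b, YZ t b c := fun t c => Finset.sum_comm
  have hZt0 : ∀ t c, 0 ≤ Zt t c := fun t c => by
    rw [hZtsum]; exact Finset.sum_nonneg fun b _ => hYZ0 t b c
  set pz : (ι → Z) → ℝ := fun z => ∑ u, μ u * outputLaw (F u) QM QW z with hpz
  have hO := fun u => outputLaw_nonneg (hF u).1 QM QW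
  have hpz0 : ∀ z, 0 ≤ pz z := fun z => Finset.sum_nonneg fun u _ => mul_nonneg (hμ.1 u) (hO u z)
  have hpz1 : ∑ z, pz z = 1 := by
    rw [hpz, Finset.sum_comm]
    simp only [← Finset.mul_sum, sum_outputLaw (hF _).2, mul_one, hμ.2]
  set p : V × (ι → X) × (ι → Y) × (ι → Z) → ℝ := fun ω =>
    μ ω.1 * (F ω.1 ω.2.1 * ((∏ t, QM.prob (ω.2.1 t) (ω.2.2.1 t)) *
      ∏ t, QW.prob (ω.2.2.1 t) (ω.2.2.2 t))) with hp
  -- The reference measure `P(z) P(x|u,z) q(u|y) ∏ P(y_t|z_t)`. It is chosen so that `log (r/p)` is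
  -- `log P(z) - log P(u,z) + log q(u|y)` minus the sum of the single-letter information densities
  -- `I`.
  set r : V × (ι → X) × (ι → Y) × (ι → Z) → ℝ := fun ω =>
    μ ω.1 * (F ω.1 ω.2.1 * ∏ t, cascade QM QW (ω.2.1 t) (ω.2.2.2 t)) *
      (pz ω.2.2.2 / (μ ω.1 * outputLaw (F ω.1) QM QW ω.2.2.2)) * q ω.1 ω.2.2.1 *
      ∏ t, (YZ t (ω.2.2.1 t) (ω.2.2.2 t) / Zt t (ω.2.2.2 t)) with hr
  have hE : ∀ g : V → (ι → X) → (ι → Y) → (ι → Z) → ℝ,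
      ∑ ω, p ω * g ω.1 ω.2.1 ω.2.2.1 ω.2.2.2 = ∑ u, μ u * ∑ x, F u x *
        ∑ y : ι → Y, (∏ t, QM.prob (x t) (y t)) *
          ∑ z : ι → Z, (∏ t, QW.prob (y t) (z t)) * g u x y z := by
    intro g
    simp only [hp, Fintype.sum_prod_type, Finset.mul_sum]
    refine Finset.sum_congr rfl fun u _ => Finset.sum_congr rfl fun x _ =>
      Finset.sum_congr rfl fun y _ => Finset.sum_congr rfl fun z _ => ?_
    ring
  have hp0 : ∀ ω, 0 ≤ p ω := fun ω => mul_nonneg (hμ.1 _) (mul_nonneg ((hF _).1 _)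
    (mul_nonneg (Finset.prod_nonneg fun _ _ => QM.prob_nonneg _ _)
      (Finset.prod_nonneg fun _ _ => QW.prob_nonneg _ _)))
  have hr0 : ∀ ω, 0 ≤ r ω := fun ω => mul_nonneg (mul_nonneg (mul_nonneg
    (mul_nonneg (hμ.1 _) (mul_nonneg ((hF _).1 _)
      (Finset.prod_nonneg fun _ _ => cascade_nonneg QM QW _ _)))
    (div_nonneg (hpz0 _) (mul_nonneg (hμ.1 _) (hO _ _)))) (hq _ _).le)
    (Finset.prod_nonneg fun _ _ => div_nonneg (hYZ0 _ _ _) (hZt0 _ _))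
  have hp1 : ∑ ω, p ω = 1 := by
    have h := hE (fun _ _ _ _ => 1)
    simp only [mul_one, sum_prod_eq_one _ (fun t => QW.sum_prob _),
      sum_prod_eq_one _ (fun t => QM.sum_prob _), (hF _).2, hμ.2] at h
    exact h
  -- Summing in the order `x`, `u`, `y`, `z` removes one conditional factor at a time.
  have hr1 : ∑ ω, r ω ≤ 1 := by
    have h1 : ∑ ω, r ω = ∑ z : ι → Z, ∑ y : ι → Y, ∑ u, ∑ x, r (u, x, y, z) := by
      rw [Fintype.sum_prod_type]
      simp only [Fintype.sum_prod_type]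
      rw [Finset.sum_congr rfl fun u _ => Finset.sum_comm]
      rw [Finset.sum_comm]
      rw [Finset.sum_congr rfl fun y _ => Finset.sum_congr rfl fun u _ => Finset.sum_comm]
      rw [Finset.sum_congr rfl fun y _ => Finset.sum_comm]
      rw [Finset.sum_comm]
    have h2 : ∀ (z : ι → Z) (y : ι → Y) u, ∑ x, r (u, x, y, z) ≤
        q u y * (pz z * ∏ t, (YZ t (y t) (z t) / Zt t (z t))) := by
      intro z y u
      have hR : 0 ≤ ∏ t, (YZ t (y t) (z t) / Zt t (z t)) :=
        Finset.prod_nonneg fun _ _ => div_nonneg (hYZ0 _ _ _) (hZt0 _ _)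
      have : ∑ x, r (u, x, y, z) = (μ u * outputLaw (F u) QM QW z) *
          (pz z / (μ u * outputLaw (F u) QM QW z)) * q u y *
          ∏ t, (YZ t (y t) (z t) / Zt t (z t)) := by
        simp only [hr]
        rw [← Finset.sum_mul, ← Finset.sum_mul, ← Finset.sum_mul, ← Finset.mul_sum]
        rfl
      rw [this]
      have h3 : (μ u * outputLaw (F u) QM QW z) * (pz z / (μ u * outputLaw (F u) QM QW z))
          ≤ pz z := by
        rcases eq_or_ne (μ u * outputLaw (F u) QM QW z) 0 with h | h
        · rw [h, zero_mul]; exact hpz0 z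
        · rw [mul_div_cancel₀ _ h]
      calc _ ≤ pz z * q u y * ∏ t, (YZ t (y t) (z t) / Zt t (z t)) := by
            have := (hq u y).le
            gcongr
        _ = _ := by ring
    have h4 : ∀ z : ι → Z, ∑ y : ι → Y, ∏ t, (YZ t (y t) (z t) / Zt t (z t)) ≤ 1 := by
      intro z
      rw [← Fintype.prod_sum (fun t b => YZ t b (z t) / Zt t (z t))]
      refine Finset.prod_le_one (fun t _ => Finset.sum_nonneg fun b _ =>
        div_nonneg (hYZ0 _ _ _) (hZt0 _ _)) fun t _ => ?_
      rw [← Finset.sum_div, ← hZtsum]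
      exact div_self_le_one _
    rw [h1, ← hpz1]
    refine Finset.sum_le_sum fun z _ => ?_
    calc ∑ y : ι → Y, ∑ u, ∑ x, r (u, x, y, z)
        ≤ ∑ y : ι → Y, pz z * ∏ t, (YZ t (y t) (z t) / Zt t (z t)) := by
          refine Finset.sum_le_sum fun y _ => ?_
          refine (Finset.sum_le_sum fun u _ => h2 z y u).trans ?_
          rw [← Finset.sum_mul]
          exact mul_le_of_le_one_left (mul_nonneg (hpz0 z)
            (Finset.prod_nonneg fun _ _ => div_nonneg (hYZ0 _ _ _) (hZt0 _ _))) (hq1 y)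
      _ ≤ pz z := by
          rw [← Finset.mul_sum]
          exact mul_le_of_le_one_right (hpz0 z) (h4 z)
  have hsupp : ∀ u x y z, 0 < p (u, x, y, z) →
      0 < μ u ∧ 0 < F u x ∧ (∀ t, 0 < QM.prob (x t) (y t)) ∧ (∀ t, 0 < QW.prob (y t) (z t)) ∧
      (∀ t, 0 < cascade QM QW (x t) (z t)) ∧ 0 < outputLaw (F u) QM QW z ∧ 0 < pz z ∧
      (∀ t, 0 < YZ t (y t) (z t)) ∧ (∀ t, 0 < Zt t (z t)) := by
    intro u x y z h
    simp only [hp] at h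
    have hne := h.ne'
    simp only [mul_ne_zero_iff, Finset.prod_ne_zero_iff, Finset.mem_univ, true_imp_iff] at hne
    obtain ⟨a1, a2, a3, a4⟩ := hne
    have b1 := lt_of_le_of_ne (hμ.1 u) a1.symm
    have b2 := lt_of_le_of_ne ((hF u).1 x) a2.symm
    have b3 := fun t => lt_of_le_of_ne (QM.prob_nonneg (x t) (y t)) (a3 t).symm
    have b4 := fun t => lt_of_le_of_ne (QW.prob_nonneg (y t) (z t)) (a4 t).symm
    have b5 : ∀ t, 0 < cascade QM QW (x t) (z t) := fun t =>
      (mul_pos (b3 t) (b4 t)).trans_le (Finset.single_le_sum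
        (f := fun b => QM.prob (x t) b * QW.prob b (z t))
        (fun b _ => mul_nonneg (QM.prob_nonneg _ b) (QW.prob_nonneg b _)) (Finset.mem_univ (y t)))
    have b6 : 0 < outputLaw (F u) QM QW z :=
      (mul_pos b2 (Finset.prod_pos fun t _ => b5 t)).trans_le (Finset.single_le_sum
        (f := fun x => F u x * ∏ t, cascade QM QW (x t) (z t))
        (fun x _ => mul_nonneg ((hF u).1 x)
          (Finset.prod_nonneg fun _ _ => cascade_nonneg QM QW _ _)) (Finset.mem_univ x))
    have b7 : 0 < pz z := (mul_pos b1 b6).trans_le (Finset.single_le_sum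
        (f := fun u => μ u * outputLaw (F u) QM QW z)
        (fun u _ => mul_nonneg (hμ.1 u) (hO u z)) (Finset.mem_univ u))
    have b8 : ∀ t, 0 < P t (x t) := by
      intro t
      have e1 : F u x ≤ ∑ x', F u x' * if x' t = x t then 1 else 0 := by
        have := Finset.single_le_sum (f := fun x' => F u x' * if x' t = x t then (1 : ℝ) else 0)
          (fun x' _ => mul_nonneg ((hF u).1 x') (by split_ifs <;> norm_num)) (Finset.mem_univ x)
        simpa using this
      have e2 := Finset.single_le_sum
        (f := fun u => μ u * ∑ x', F u x' * if x' t = x t then (1 : ℝ) else 0)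
        (fun u _ => mul_nonneg (hμ.1 u) (Finset.sum_nonneg fun x' _ => mul_nonneg ((hF u).1 x')
          (by split_ifs <;> norm_num))) (Finset.mem_univ u)
      exact (mul_pos b1 (b2.trans_le e1)).trans_le e2
    have b9 : ∀ t, 0 < YZ t (y t) (z t) := fun t =>
      (mul_pos (mul_pos (b8 t) (b3 t)) (b4 t)).trans_le (Finset.single_le_sum
        (f := fun a => P t a * QM.prob a (y t) * QW.prob (y t) (z t))
        (fun a _ => mul_nonneg (mul_nonneg (hPpos t a) (QM.prob_nonneg a _))
          (QW.prob_nonneg _ _)) (Finset.mem_univ (x t)))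
    have b10 : ∀ t, 0 < Zt t (z t) := fun t => by
      rw [hZtsum]
      exact (b9 t).trans_le (Finset.single_le_sum (f := fun b => YZ t b (z t))
        (fun b _ => hYZ0 t b _) (Finset.mem_univ (y t)))
    exact ⟨b1, b2, b3, b4, b5, b6, b7, b9, b10⟩
  have hpos : ∀ ω, 0 < p ω → 0 < r ω := by
    rintro ⟨u, x, y, z⟩ h
    obtain ⟨b1, b2, b3, b4, b5, b6, b7, b8, b9⟩ := hsupp u x y z h
    exact mul_pos (mul_pos (mul_pos (mul_pos b1 (mul_pos b2 (Finset.prod_pos fun t _ => b5 t)))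
      (div_pos b7 (mul_pos b1 b6))) (hq u y)) (Finset.prod_pos fun t _ => div_pos (b8 t) (b9 t))
  set I : ι → X → Y → Z → ℝ := fun t a b c =>
    Real.logb 2 (QM.prob a b) + Real.logb 2 (QW.prob b c) + Real.logb 2 (Zt t c)
      - Real.logb 2 (cascade QM QW a c) - Real.logb 2 (YZ t b c) with hI
  have hexp : ∀ ω, p ω * (Real.logb 2 (r ω) - Real.logb 2 (p ω)) =
      p ω * Real.logb 2 (pz ω.2.2.2)
      - p ω * Real.logb 2 (μ ω.1 * outputLaw (F ω.1) QM QW ω.2.2.2)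
      - p ω * -Real.logb 2 (q ω.1 ω.2.2.1)
      - ∑ t, p ω * I t (ω.2.1 t) (ω.2.2.1 t) (ω.2.2.2 t) := by
    rintro ⟨u, x, y, z⟩
    rcases (hp0 (u, x, y, z)).eq_or_lt with h | h
    · simp [← h]
    obtain ⟨b1, b2, b3, b4, b5, b6, b7, b8, b9⟩ := hsupp u x y z h
    have c5 := Finset.prod_pos fun t (_ : t ∈ Finset.univ) => b5 t
    have c3 := Finset.prod_pos fun t (_ : t ∈ Finset.univ) => b3 t
    have c4 := Finset.prod_pos fun t (_ : t ∈ Finset.univ) => b4 t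
    have c8 := Finset.prod_pos fun t (_ : t ∈ Finset.univ) => div_pos (b8 t) (b9 t)
    have e1 : Real.logb 2 (r (u, x, y, z)) = Real.logb 2 (μ u) + Real.logb 2 (F u x)
        + ∑ t, Real.logb 2 (cascade QM QW (x t) (z t))
        + (Real.logb 2 (pz z) - Real.logb 2 (μ u * outputLaw (F u) QM QW z))
        + Real.logb 2 (q u y)
        + ∑ t, (Real.logb 2 (YZ t (y t) (z t)) - Real.logb 2 (Zt t (z t))) := by
      simp only [hr]
      rw [Real.logb_mul (by have := hq u y; positivity) c8.ne',
        Real.logb_mul (by positivity) (hq u y).ne',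
        Real.logb_mul (by positivity) (by positivity),
        Real.logb_mul b1.ne' (by positivity), Real.logb_mul b2.ne' c5.ne',
        Real.logb_div b7.ne' (by positivity), Real.logb_prod _ _ (fun t _ => (b5 t).ne'),
        Real.logb_prod _ _ (fun t _ => (div_pos (b8 t) (b9 t)).ne')]
      have : ∀ t, Real.logb 2 (YZ t (y t) (z t) / Zt t (z t)) =
          Real.logb 2 (YZ t (y t) (z t)) - Real.logb 2 (Zt t (z t)) := fun t =>
        Real.logb_div (b8 t).ne' (b9 t).ne'
      simp only [this]
      ring
    have e2 : Real.logb 2 (p (u, x, y, z)) = Real.logb 2 (μ u) + Real.logb 2 (F u x)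
        + ∑ t, Real.logb 2 (QM.prob (x t) (y t)) + ∑ t, Real.logb 2 (QW.prob (y t) (z t)) := by
      simp only [hp]
      rw [Real.logb_mul b1.ne' (by positivity), Real.logb_mul b2.ne' (by positivity),
        Real.logb_mul c3.ne' c4.ne', Real.logb_prod _ _ (fun t _ => (b3 t).ne'),
        Real.logb_prod _ _ (fun t _ => (b4 t).ne')]
      ring
    rw [e1, e2, ← Finset.mul_sum]
    simp only [hI, Finset.sum_add_distrib, Finset.sum_sub_distrib]
    ring
  have hgibbs := sum_mul_logb_sub_le p r hp0 hr0 hpos (by rw [hp1]; exact hr1)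
  rw [Finset.sum_congr rfl fun ω _ => hexp ω, Finset.sum_sub_distrib, Finset.sum_sub_distrib,
    Finset.sum_sub_distrib, Finset.sum_comm] at hgibbs
  have f1 : ∑ ω, p ω * Real.logb 2 (pz ω.2.2.2) = -entropy pz := by
    rw [hE (fun _ _ _ z => Real.logb 2 (pz z))]
    simp only [← sum_mul_outputLaw]
    simp only [entropy, Finset.sum_neg_distrib, neg_neg, Finset.mul_sum]
    rw [Finset.sum_comm]
    refine Finset.sum_congr rfl fun z _ => ?_
    simp only [← mul_assoc]
    rw [← Finset.sum_mul]
  have f2 : ∑ ω, p ω * Real.logb 2 (μ ω.1 * outputLaw (F ω.1) QM QW ω.2.2.2)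
      = -entropy (fun t : V × (ι → Z) => μ t.1 * outputLaw (F t.1) QM QW t.2) := by
    rw [hE (fun u _ _ z => Real.logb 2 (μ u * outputLaw (F u) QM QW z))]
    simp only [← sum_mul_outputLaw]
    simp only [entropy, Finset.sum_neg_distrib, neg_neg, Finset.mul_sum, Fintype.sum_prod_type,
      mul_assoc]
  have f3 : ∑ ω, p ω * -Real.logb 2 (q ω.1 ω.2.2.1) = ∑ u, μ u * ∑ x, F u x *
      ∑ y : ι → Y, (∏ t, QM.prob (x t) (y t)) * -Real.logb 2 (q u y) := by
    rw [hE (fun u _ y _ => -Real.logb 2 (q u y))]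
    simp only [← Finset.sum_mul, sum_prod_eq_one _ (fun t => QW.sum_prob _), one_mul]
  have f4 : ∀ t, ∑ ω, p ω * I t (ω.2.1 t) (ω.2.2.1 t) (ω.2.2.2 t) ≤ secrecyCapacity QM QW := by
    intro t
    refine le_trans (le_of_eq ?_) (condMutualInfo_le_secrecyCapacity QM QW (hPsimplex t))
    rw [condMutualInfo_channel QM QW (hPpos t), hPmarg t (fun a => ∑ b, QM.prob a b *
      ∑ c, QW.prob b c * I t a b c), hE (fun _ x y z => I t (x t) (y t) (z t))]
    refine Finset.sum_congr rfl fun u _ => ?_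
    congr 1
    refine Finset.sum_congr rfl fun x _ => ?_
    congr 1
    rw [← sum_prod_mul_eval (fun i b => QM.prob (x i) b) (fun i => QM.sum_prob _) t]
    refine Finset.sum_congr rfl fun y _ => ?_
    congr 1
    exact sum_prod_mul_eval (fun i c => QW.prob (y i) c) (fun i => QW.sum_prob _) t
      (fun c => I t (x t) (y t) c)
  rw [f1, f2, f3] at hgibbs
  have f5 := Finset.sum_le_sum fun t (_ : t ∈ (Finset.univ : Finset ι)) => f4 t
  rw [Finset.sum_const, Finset.card_univ, nsmul_eq_mul] at f5
  linarith

end Converse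

end Wiretap

namespace Wiretap

/-! ### From bit errors to log-loss, and the bound on `log α`. -/

section Reliability

variable {U X Y Z Se Sd : Type*} [Fintype X] [Fintype Y] [Fintype Z]
  {k m L : ℕ}

/-- Posterior probability of the symbol `a` given the decoded symbol `v` for the symmetric channel
with error probability `ε`. -/
noncomputable def symmetricPosterior [Fintype U] [DecidableEq U] (ε : ℝ)
    (v a : U) : ℝ :=
  if v ≠ a then ε / ((Fintype.card U : ℝ) - 1) else 1 - ε

theorem symmetricPosterior_pos [Fintype U] [DecidableEq U] (hU : 2 ≤ Fintype.card U) {ε : ℝ}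
    (h0 : 0 < ε) (h1 : ε < 1)
    (v a : U) : 0 < symmetricPosterior ε v a := by
  have : (2 : ℝ) ≤ Fintype.card U := by exact_mod_cast hU
  unfold symmetricPosterior
  split_ifs
  · exact div_pos h0 (by linarith)
  · linarith

theorem sum_symmetricPosterior [Fintype U] [DecidableEq U] (hU : 2 ≤ Fintype.card U) (ε : ℝ)
    (v : U) :
    ∑ a, symmetricPosterior ε v a = 1 := by
  have h2 : (2 : ℝ) ≤ Fintype.card U := by exact_mod_cast hU
  have h : ∀ a, symmetricPosterior ε v a = ε / ((Fintype.card U : ℝ) - 1)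
      + if v = a then 1 - ε - ε / ((Fintype.card U : ℝ) - 1) else 0 := by
    intro a
    unfold symmetricPosterior
    by_cases h : v = a <;> simp [h]
  simp only [h, Finset.sum_add_distrib, Finset.sum_const, Finset.card_univ, nsmul_eq_mul,
    Finset.sum_ite_eq, Finset.mem_univ, if_true]
  have : (Fintype.card U : ℝ) - 1 ≠ 0 := by linarith
  field_simp
  ring

/-- The expected logarithmic loss of the symmetric posterior over a chunk. -/
theorem chunk_loss_le [Fintype U] [DecidableEq U] (hU : 2 ≤ Fintype.card U) (hk : 0 < k)
    {ε : ℝ} (h0 : 0 < ε)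
    (hε : ε ≤ 1 - 1 / (Fintype.card U : ℝ)) (E : Encoder U X Se k m) (D : Decoder U Y Sd k m)
    (QM : DMC X Y) (u : Fin k → U) (se : Se) (sd : Sd)
    (hrel : bitErrorProb E D QM u se sd ≤ ε) :
    ∑ x, E.prob u se x * ∑ y : Fin m → Y, (∏ j, QM.prob (x j) (y j)) *
      ∑ j, -Real.logb 2 (symmetricPosterior ε (D.out y sd j) (u j))
      ≤ k * Delta (Fintype.card U) ε := by
  set α : ℝ := (Fintype.card U : ℝ) with hα
  have h2 : (2 : ℝ) ≤ α := by rw [hα]; exact_mod_cast hU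
  have hk0 : (0 : ℝ) < k := by exact_mod_cast hk
  have h1 : ε < 1 := by
    have : 0 < 1 / α := by positivity
    linarith
  set a := -Real.logb 2 (1 - ε) with ha
  set b := -Real.logb 2 (ε / (α - 1)) with hb
  -- Here `ε ≤ 1 - 1/α` enters: a wrong symbol costs at least as much as a right one, so the
  -- expected loss increases with the error probability, and at `ε` it equals `Δ(ε)`.
  have hab : a ≤ b := by
    refine neg_le_neg (Real.logb_le_logb_of_le (by norm_num) (div_pos h0 (by linarith)) ?_)
    rw [div_le_iff₀ (by linarith)]
    have : ε * α ≤ (1 - 1 / α) * α := by gcongr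
    rw [sub_mul, one_mul, div_mul_cancel₀ _ (by linarith)] at this
    linarith
  have hloss : ∀ v w : U, -Real.logb 2 (symmetricPosterior ε v w)
      = a + (b - a) * if v ≠ w then 1 else 0 := by
    intro v w
    unfold symmetricPosterior
    split_ifs <;> simp [ha, hb, hα]
  have hsum : ∑ x, E.prob u se x * ∑ y : Fin m → Y, (∏ j, QM.prob (x j) (y j)) *
      ∑ j, -Real.logb 2 (symmetricPosterior ε (D.out y sd j) (u j))
      = k * a + (b - a) * (k * bitErrorProb E D QM u se sd) := by
    have e1 : k * bitErrorProb E D QM u se sd = ∑ x, E.prob u se x * ∑ y : Fin m → Y,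
        (∏ j, QM.prob (x j) (y j)) * ∑ i, (if D.out y sd i ≠ u i then (1 : ℝ) else 0) := by
      unfold bitErrorProb
      rw [← mul_assoc, mul_one_div_cancel hk0.ne', one_mul, Finset.sum_comm]
      refine Finset.sum_congr rfl fun x _ => ?_
      rw [Finset.sum_comm, Finset.mul_sum]
      refine Finset.sum_congr rfl fun y _ => ?_
      rw [Finset.mul_sum, Finset.mul_sum]
      exact Finset.sum_congr rfl fun i _ => mul_assoc _ _ _
    have e2 : ∀ c : ℝ, c = ∑ x, E.prob u se x * ∑ y : Fin m → Y,
        (∏ j, QM.prob (x j) (y j)) * c := by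
      intro c
      simp only [← Finset.sum_mul, sum_prod_eq_one _ (fun t => QM.sum_prob _), one_mul,
        (E.prob_mem u se).2]
    rw [e1, e2 (k * a), Finset.mul_sum, ← Finset.sum_add_distrib]
    refine Finset.sum_congr rfl fun x _ => ?_
    rw [mul_left_comm, ← mul_add, Finset.mul_sum _ _ (b - a), ← Finset.sum_add_distrib]
    congr 1
    refine Finset.sum_congr rfl fun y _ => ?_
    simp only [hloss, Finset.sum_add_distrib, Finset.sum_const, Finset.card_univ,
      Fintype.card_fin, nsmul_eq_mul, ← Finset.mul_sum]
    ring
  rw [hsum]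
  have h3 : (b - a) * (k * bitErrorProb E D QM u se sd) ≤ (b - a) * (k * ε) := by
    have : 0 ≤ b - a := by linarith
    gcongr
  refine (add_le_add_right h3 _).trans (le_of_eq ?_)
  unfold Delta
  rw [hb, Real.logb_div h0.ne' (by linarith)]
  ring

/-- For a fixed source string the encoder states are deterministic, so the chunks are independent
and an additive loss splits into per-chunk expectations. -/
theorem Encoder.sum_prod_prob_mul (E : Encoder U X Se k m) (QM : DMC X Y)
    (u : Fin L → Fin k → U) (φ : Fin L → (Fin m → Y) → ℝ) :
    ∑ x : Fin L → Fin m → X, (∏ i, E.prob (u i) (E.state u i) (x i)) *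
      ∑ y : Fin L → Fin m → Y, (∏ i, ∏ j, QM.prob (x i j) (y i j)) * ∑ i, φ i (y i)
    = ∑ i, ∑ x, E.prob (u i) (E.state u i) x *
      ∑ y : Fin m → Y, (∏ j, QM.prob (x j) (y j)) * φ i y := by
  have h1 : ∀ x : Fin L → Fin m → X,
      ∑ y : Fin L → Fin m → Y, (∏ i, ∏ j, QM.prob (x i j) (y i j)) * ∑ i, φ i (y i)
      = ∑ i, ∑ y : Fin m → Y, (∏ j, QM.prob (x i j) (y j)) * φ i y := by
    intro x
    simp only [Finset.mul_sum]
    rw [Finset.sum_comm]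
    refine Finset.sum_congr rfl fun i _ => ?_
    exact sum_prod_mul_eval (fun i (y : Fin m → Y) => ∏ j, QM.prob (x i j) (y j))
      (fun i => sum_prod_eq_one _ fun j => QM.sum_prob _) i (φ i)
  simp only [h1]
  refine (Finset.sum_congr rfl fun x _ => Finset.mul_sum _ _ _).trans ?_
  rw [Finset.sum_comm]
  refine Finset.sum_congr rfl fun i _ => ?_
  exact sum_prod_mul_eval (fun i x => E.prob (u i) (E.state u i) x)
    (fun i => (E.prob_mem _ _).2) i
    (fun x => ∑ y : Fin m → Y, (∏ j, QM.prob (x j) (y j)) * φ i y)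

/-- Law of the channel input string, indexed by channel uses. -/
noncomputable def Encoder.inputLaw (E : Encoder U X Se k m) (u : Fin L → Fin k → U)
    (x : Fin L × Fin m → X) : ℝ :=
  ∏ i, E.prob (u i) (E.state u i) (fun j => x (i, j))

theorem Encoder.inputLaw_mem (E : Encoder U X Se k m) (u : Fin L → Fin k → U) :
    E.inputLaw u ∈ stdSimplex ℝ (Fin L × Fin m → X) := by
  classical
  refine ⟨fun x => Finset.prod_nonneg fun i _ => (E.prob_mem _ _).1 _, ?_⟩
  rw [← (Equiv.curry (Fin L) (Fin m) X).symm.sum_comp]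
  exact sum_prod_eq_one (fun i x => E.prob (u i) (E.state u i) x) (fun i => (E.prob_mem _ _).2)

theorem wiretapLaw_eq_outputLaw (E : Encoder U X Se k m) (QM : DMC X Y) (QW : DMC Y Z)
    (u : Fin L → Fin k → U) (z : Fin L × Fin m → Z) :
    wiretapLaw E QM QW u (Equiv.curry _ _ _ z) = outputLaw (E.inputLaw u) QM QW z := by
  rw [outputLaw_eq_sum, ← (Equiv.curry (Fin L) (Fin m) X).symm.sum_comp]
  unfold wiretapLaw
  refine Finset.sum_congr rfl fun x _ => ?_
  rw [← (Equiv.curry (Fin L) (Fin m) Y).symm.sum_comp, Finset.mul_sum]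
  refine Finset.sum_congr rfl fun y _ => ?_
  simp only [systemLaw, Encoder.inputLaw, Fintype.prod_prod_type, mul_assoc]
  rfl

theorem mutualInfo_wiretapLaw [Fintype U] (E : Encoder U X Se k m) (QM : DMC X Y)
    (QW : DMC Y Z)
    (μ : (Fin L → Fin k → U) → ℝ) :
    mutualInfo (fun (u : Fin L → Fin k → U) (z : Fin L → Fin m → Z) =>
        μ u * wiretapLaw E QM QW u z)
      = entropy μ + entropy (fun z : Fin L × Fin m → Z =>
          ∑ u, μ u * outputLaw (E.inputLaw u) QM QW z)
        - entropy (fun t : (Fin L → Fin k → U) × (Fin L × Fin m → Z) =>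
          μ t.1 * outputLaw (E.inputLaw t.1) QM QW t.2) := by
  classical
  have h1 : ∀ u : Fin L → Fin k → U, ∑ z, μ u * wiretapLaw E QM QW u z = μ u := by
    intro u
    rw [← (Equiv.curry (Fin L) (Fin m) Z).sum_comp, ← Finset.mul_sum]
    simp only [wiretapLaw_eq_outputLaw]
    rw [sum_outputLaw (E.inputLaw_mem u).2, mul_one]
  unfold mutualInfo
  simp only [h1]
  rw [← entropy_comp_equiv (Equiv.curry (Fin L) (Fin m) Z),
    ← entropy_comp_equiv (Equiv.prodCongr (Equiv.refl (Fin L → Fin k → U))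
      (Equiv.curry (Fin L) (Fin m) Z))]
  simp only [Equiv.prodCongr_apply, Prod.map, Equiv.refl_apply, wiretapLaw_eq_outputLaw]

/-- Reliable and secure transmission of uniformly distributed source strings bounds the secrecy
capacity from below. -/
theorem logb_card_le [Fintype U] [DecidableEq U] (hU : 2 ≤ Fintype.card U) (hk : 0 < k)
    {εr εs : ℝ} (h0 : 0 < εr)
    (hεr : εr ≤ 1 - 1 / (Fintype.card U : ℝ)) (E : Encoder U X Se k m) (D : Decoder U Y Sd k m)
    [Nonempty Sd] (QM : DMC X Y) (QW : DMC Y Z) (hrel : Reliable E D QM εr)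
    (hsec : Secure E QM QW εs) :
    Real.logb 2 (Fintype.card U) ≤
      Delta (Fintype.card U) εr + εs + (m : ℝ) / k * secrecyCapacity QM QW := by
  classical
  have : Nonempty U := Fintype.card_pos_iff.1 (by omega)
  obtain ⟨sd⟩ := ‹Nonempty Sd›
  -- One sufficiently large block length is enough; it is unrelated to the `n` of the theorem.
  obtain ⟨L, hL, hLpos⟩ := (hsec.and (eventually_ge_atTop 1)).exists
  have hk0 : (0 : ℝ) < k := by exact_mod_cast hk
  have hL0 : (0 : ℝ) < L := by exact_mod_cast hLpos
  have h2 : (2 : ℝ) ≤ Fintype.card U := by exact_mod_cast hU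
  have h1 : εr < 1 := by
    have : 0 < 1 / (Fintype.card U : ℝ) := by positivity
    linarith
  set μ : (Fin L → Fin k → U) → ℝ :=
    fun _ => (Fintype.card (Fin L → Fin k → U) : ℝ)⁻¹ with hμdef
  have hμ : μ ∈ stdSimplex ℝ (Fin L → Fin k → U) := by
    refine ⟨fun _ => by positivity, ?_⟩
    rw [hμdef, Finset.sum_const, Finset.card_univ, nsmul_eq_mul]
    exact mul_inv_cancel₀ (by exact_mod_cast Fintype.card_ne_zero)
  have hent : entropy μ = L * (k * Real.logb 2 (Fintype.card U)) := by
    rw [hμdef, entropy_const]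
    simp [Real.logb_pow]
  have hI := hL μ hμ
  rw [mutualInfo_wiretapLaw, hent] at hI
  -- The decoder is restarted in the same state `sd` at every chunk. Reliability covers all pairs of
  -- initial states, so its actual state need not be tracked and no `log q_d` term appears.
  set q : (Fin L → Fin k → U) → (Fin L × Fin m → Y) → ℝ := fun u y =>
    ∏ i, ∏ j, symmetricPosterior εr (D.out (fun l => y (i, l)) sd j) (u i j) with hq
  have hq0 : ∀ u y, 0 < q u y := fun u y => Finset.prod_pos fun i _ => Finset.prod_pos fun j _ =>
    symmetricPosterior_pos hU h0 h1 _ _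
  have hq1 : ∀ y, ∑ u, q u y ≤ 1 := fun y => le_of_eq <|
    sum_prod_eq_one (fun i (a : Fin k → U) =>
      ∏ j, symmetricPosterior εr (D.out (fun l => y (i, l)) sd j) (a j))
      fun i => sum_prod_eq_one _ fun j => sum_symmetricPosterior hU _ _
  have hmain := equivocation_le μ hμ E.inputLaw E.inputLaw_mem QM QW q hq0 hq1
  have hloss : ∀ u, ∑ x, E.inputLaw u x * ∑ y : Fin L × Fin m → Y,
      (∏ t, QM.prob (x t) (y t)) * -Real.logb 2 (q u y)
      ≤ L * (k * Delta (Fintype.card U) εr) := by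
    intro u
    have e : ∑ x, E.inputLaw u x * ∑ y : Fin L × Fin m → Y,
        (∏ t, QM.prob (x t) (y t)) * -Real.logb 2 (q u y) =
        ∑ x : Fin L → Fin m → X, (∏ i, E.prob (u i) (E.state u i) (x i)) *
          ∑ y : Fin L → Fin m → Y, (∏ i, ∏ j, QM.prob (x i j) (y i j)) *
            ∑ i, ∑ j, -Real.logb 2 (symmetricPosterior εr (D.out (y i) sd j) (u i j)) := by
      rw [← (Equiv.curry (Fin L) (Fin m) X).symm.sum_comp]
      refine Finset.sum_congr rfl fun x _ => ?_
      rw [← (Equiv.curry (Fin L) (Fin m) Y).symm.sum_comp]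
      congr 1
      refine Finset.sum_congr rfl fun y _ => ?_
      rw [Fintype.prod_prod_type]
      congr 1
      simp only [hq]
      rw [Real.logb_prod _ _ fun i _ => (Finset.prod_pos fun j _ =>
        symmetricPosterior_pos hU h0 h1 _ _).ne', ← Finset.sum_neg_distrib]
      refine Finset.sum_congr rfl fun i _ => ?_
      rw [Real.logb_prod _ _ fun j _ => (symmetricPosterior_pos hU h0 h1 _ _).ne',
        ← Finset.sum_neg_distrib]
      rfl
    rw [e, E.sum_prod_prob_mul QM u (fun i y =>
      ∑ j, -Real.logb 2 (symmetricPosterior εr (D.out y sd j) (u i j)))]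
    refine (Finset.sum_le_sum fun i _ => chunk_loss_le hU hk h0 hεr E D QM (u i) _ sd
      (hrel _ _ _)).trans ?_
    simp
  have hloss' : ∑ u, μ u * ∑ x, E.inputLaw u x * ∑ y : Fin L × Fin m → Y,
      (∏ t, QM.prob (x t) (y t)) * -Real.logb 2 (q u y)
      ≤ L * (k * Delta (Fintype.card U) εr) := by
    refine (Finset.sum_le_sum fun u _ => mul_le_mul_of_nonneg_left (hloss u) (hμ.1 u)).trans ?_
    rw [← Finset.sum_mul, hμ.2, one_mul]
  simp only [Fintype.card_prod, Fintype.card_fin] at hmain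
  push_cast at hmain hI
  have hfin : (L * k : ℝ) * Real.logb 2 (Fintype.card U) ≤ (L * k : ℝ) *
      (Delta (Fintype.card U) εr + εs + (m : ℝ) / k * secrecyCapacity QM QW) := by
    have : (L * k : ℝ) * (Delta (Fintype.card U) εr + εs + (m : ℝ) / k * secrecyCapacity QM QW)
        = L * (k * Delta (Fintype.card U) εr) + k * L * εs + L * m * secrecyCapacity QM QW := by
      field_simp
    rw [this]
    linarith
  exact le_of_mul_le_mul_left hfin (by positivity)

end Reliability

end Wiretap

theorem theorem1 (α : ℕ) (hα : 2 ≤ α) :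
    ∃ ε : ℕ → ℝ, Filter.Tendsto ε Filter.atTop (nhds 0) ∧ (∀ n, 0 ≤ ε n ∧ ε n < 1) ∧
      ∀ (U X Y Z Se Sd : Type*) [Fintype U] [DecidableEq U] [Fintype X] [Fintype Y] [Fintype Z]
        [Fintype Se] [Fintype Sd] [Nonempty Sd] (qe qd k m : ℕ)
        (E : Wiretap.Encoder U X Se k m) (D : Wiretap.Decoder U Y Sd k m)
        (QM : Wiretap.DMC X Y) (QW : Wiretap.DMC Y Z) (εr εs : ℝ),
        Fintype.card U = α → Fintype.card Se = qe → Fintype.card Sd = qd →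
        0 < k → 0 < m → 0 < εr → εr ≤ 1 - 1 / (α : ℝ) → 0 < εs →
        Wiretap.Reliable E D QM εr → Wiretap.Secure E QM QW εs →
        ∀ n : ℕ, 2 ≤ n → k ∣ n → ∀ u : Fin n → U,
          (0 < Wiretap.secrecyCapacity QM QW →
            (m : ℝ) / k ≥
              (Wiretap.lzComplexity u - Wiretap.Delta α εr - εs - Wiretap.zeta α (ε n) n qd k)
                / Wiretap.secrecyCapacity QM QW) ∧
          (Wiretap.secrecyCapacity QM QW = 0 →
            Wiretap.lzComplexity u - Wiretap.Delta α εr - εs - Wiretap.zeta α (ε n) n qd k ≤ 0) := by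
  -- `zeta` is nondecreasing in its second argument, so `ε = 0` gives the sharpest bound.
  refine ⟨fun _ => 0, tendsto_const_nhds, fun _ => ⟨le_rfl, one_pos⟩, ?_⟩
  intro U X Y Z Se Sd _ _ _ _ _ _ _ _ qe qd k m E D QM QW εr εs hcU _ hcd hk _ h0 hεr _ hrel hsec
    n hn hkn u
  subst hcU
  have hq : 0 < qd := hcd ▸ Fintype.card_pos
  have hlz := Wiretap.lzComplexity_le hα hn hk hkn hq u
  have hcap := Wiretap.logb_card_le hα hk h0 hεr E D QM QW hrel hsec
  refine ⟨fun hC => ?_, fun hC => ?_⟩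
  · rw [ge_iff_le, div_le_iff₀ hC]
    linarith
  · rw [hC, mul_zero] at hcap
    linarith
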